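/- Let $G$ be a Hausdorff topological abelian group which is precompact (for every nonempty open set $U\subseteq G$ there is a finite set $F\subseteq G$ with $G=F+U$) and whose underlying topological space is a Baire space (every countable intersection of dense open sets is dense). Let $\widehat{G}_p$ be the group of all continuous homomorphisms $\chi\colon G\to\mathbb{T}=\mathbb{R}/\mathbb{Z}$, equipped with the topology of pointwise convergence on $G$. Then $G$ is $g$-barrelled, that is, every compact subset $K$ of $\widehat{G}_p$ is equicontinuous as a family of functions $G\to\mathbb{T}$: for every $x_0\in G$ and every neighbourhood $W$ of $0$ in $\mathbb{T}$ there is a neighbourhood $V$ of $x_0$ in $G$ such that $\chi(x)-\chi(x_0)\in W$ for all $x\in V$ and all $\chi\in K$. -/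

import Mathlib

/-- The precompact Hausdorff topological (additive) groups: finitely many translates of any
nonempty open set cover the group. -/
structure IsTotallyBoundedGroup (G : Type*) [AddGroup G] [TopologicalSpace G] : Prop where
  precompact : ∀ U : Set G, IsOpen U → U.Nonempty →
    ∃ F : Set G, F.Finite ∧ (⋃ x ∈ F, (fun u => x + u) '' U) = Set.univ
  hausdorff : T2Space G

/-- The group of all continuous characters `G → ℝ/ℤ`, which carries (below) the finite-open
topology, that is, the topology of pointwise convergence on `G`. -/
def PointwiseDual (G : Type*) [AddCommGroup G] [TopologicalSpace G] : Type _ :=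
  G →ₜ+ UnitAddCircle

namespace PointwiseDual

variable {G : Type*} [AddCommGroup G] [TopologicalSpace G]

noncomputable instance : AddCommGroup (PointwiseDual G) :=
  inferInstanceAs (AddCommGroup (G →ₜ+ UnitAddCircle))

instance : FunLike (PointwiseDual G) G UnitAddCircle :=
  inferInstanceAs (FunLike (G →ₜ+ UnitAddCircle) G UnitAddCircle)

/-- The finite-open topology: the coarsest topology for which every evaluation
`χ ↦ χ g`, `g ∈ G`, is continuous. -/
instance : TopologicalSpace (PointwiseDual G) :=
  TopologicalSpace.induced (fun (χ : PointwiseDual G) (g : G) => χ g) Pi.topologicalSpace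

end PointwiseDual

/-- A topological abelian group is `g`-barrelled if every compact set of characters, for the
finite-open topology, is equicontinuous. -/
def IsGBarrelled (G : Type*) [AddCommGroup G] [TopologicalSpace G] : Prop :=
  ∀ K : Set (PointwiseDual G), IsCompact K →
    Equicontinuous (fun (χ : K) (g : G) => (χ : PointwiseDual G) g)

open Set Topology

/-! Compact sets of characters are in fact finite, and a finite set of continuous maps is
equicontinuous. Suppose `K` is compact and infinite. A purely topological lemma,
`IsCompact.exists_countable_infinite_network_at`, gives a point `z` and countably many infinite sets
of characters such that every neighbourhood of `z` contains one of them. Each `x` in `G` defines a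
neighbourhood of `z`, so the closed sets on which all of some `O` is uniformly close to `z` cover
`G`. By Baire one of them has interior, and precompactness allows only finitely many characters so
close to `z` there, although `O` is infinite. -/

/-- A compact infinite set in which no two compact infinite subsets are disjoint accumulates at a
single point. -/
theorem IsCompact.exists_forall_finite_diff {X : Type*} [TopologicalSpace X] [T2Space X]
    {Q : Set X} (hQ : IsCompact Q) (hinf : Q.Infinite)
    (h : ∀ A B : Set X, A ⊆ Q → B ⊆ Q → IsCompact A → IsCompact B → A.Infinite → B.Infinite →
      ¬ Disjoint A B) :
    ∃ z ∈ Q, ∀ U : Set X, IsOpen U → z ∈ U → (Q \ U).Finite := by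
  obtain ⟨z, hzQ, hz⟩ := hinf.exists_accPt_of_subset_isCompact hQ subset_rfl
  refine ⟨z, hzQ, fun U hU hzU => ?_⟩
  by_contra hfin
  have hc : IsCompact (Q \ U) := hQ.diff hU
  obtain ⟨A, B, hA, hB, hQA, hzB, hAB⟩ :=
    SeparatedNhds.of_isCompact_isCompact hc (isCompact_singleton (x := z))
      (disjoint_singleton_right.2 fun hmem => hmem.2 hzU)
  have hinf' : (Q ∩ B).Infinite := by
    rw [inter_comm]
    exact Infinite.of_accPt (hz.nhds_inter (hB.mem_nhds (hzB rfl)))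
  refine h (Q \ U) (Q \ A) sdiff_subset sdiff_subset hc (hQ.diff hA) hfin
    (hinf'.mono fun x hx => ⟨hx.1, fun hxA => disjoint_left.1 hAB hxA hx.2⟩) ?_
  exact disjoint_left.2 fun x hx hx' => hx'.2 (hQA hx)

/-- If a family of compact sets is given, there is a minimal compact set meeting all of them. -/
theorem IsCompact.exists_minimal_meeting {X ι : Type*} [TopologicalSpace X] [T2Space X]
    {K : Set X} (hK : IsCompact K) (P : ι → Set X) (hP : ∀ i, IsClosed (P i))
    (hKP : ∀ i, (K ∩ P i).Nonempty) :
    ∃ L ⊆ K, Minimal (fun L => IsCompact L ∧ ∀ i, (L ∩ P i).Nonempty) L := by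
  refine zorn_superset_nonempty {L | IsCompact L ∧ ∀ i, (L ∩ P i).Nonempty} ?_ K ⟨hK, hKP⟩
  intro c hc hchain hne
  obtain ⟨s₀, hs₀⟩ := hne
  refine ⟨⋂₀ c, ⟨(hc hs₀).1.of_isClosed_subset
    (isClosed_sInter fun s hs => (hc hs).1.isClosed) (sInter_subset_of_mem hs₀), fun i => ?_⟩,
    fun s hs => sInter_subset_of_mem hs⟩
  have : Nonempty c := ⟨⟨s₀, hs₀⟩⟩
  have key := IsCompact.nonempty_iInter_of_directed_nonempty_isCompact_isClosed
    (fun s : c => (s : Set X) ∩ P i)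
    (fun s t => by
      rcases hchain.total s.2 t.2 with hst | hts
      · exact ⟨s, subset_rfl, inter_subset_inter_left _ hst⟩
      · exact ⟨t, inter_subset_inter_left _ hts, subset_rfl⟩)
    (fun s => (hc s.2).2 i) (fun s => (hc s.2).1.inter_right (hP i))
    (fun s => (hc s.2).1.isClosed.inter (hP i))
  obtain ⟨x, hx⟩ := key
  rw [mem_iInter] at hx
  exact ⟨x, fun s hs => (hx ⟨s, hs⟩).1, (hx ⟨s₀, hs₀⟩).2⟩

/-- Disjointly branching sets that are all met by `L` meet it in infinite sets. -/
theorem infinite_inter_of_disjoint_branches {X : Type*} (P : List Bool → Set X)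
    (hsub : ∀ b s, P (b :: s) ⊆ P s) (hdisj : ∀ s, Disjoint (P (false :: s)) (P (true :: s)))
    {L : Set X} (hL : ∀ s, (L ∩ P s).Nonempty) (s : List Bool) : (L ∩ P s).Infinite := by
  -- Infinite descent: `L` also meets the sibling branch, so passing to a child strictly shrinks a
  -- finite trace.
  suffices H : ∀ n s, (L ∩ P s).Finite → (L ∩ P s).ncard ≠ n from
    fun hfin => H _ s hfin rfl
  intro n
  induction n using Nat.strong_induction_on with
  | _ n ih =>
    intro s hfin hn
    have hss : L ∩ P (false :: s) ⊂ L ∩ P s := by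
      refine (inter_subset_inter_right _ (hsub _ _)).ssubset_of_ne fun heq => ?_
      obtain ⟨x, hx⟩ := hL (true :: s)
      have hx' : x ∈ L ∩ P (false :: s) := heq ▸ ⟨hx.1, hsub _ _ hx.2⟩
      exact disjoint_left.1 (hdisj s) hx'.2 hx.2
    exact ih _ (hn ▸ ncard_lt_ncard hss hfin) (false :: s) (hfin.subset hss.subset) rfl

/-- Every infinite compact Hausdorff set has a point all of whose neighbourhoods contain a member
of a fixed countable family of infinite subsets. -/
theorem IsCompact.exists_countable_infinite_network_at {X : Type*} [TopologicalSpace X]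
    [T2Space X] {K : Set X} (hK : IsCompact K) (hinf : K.Infinite) :
    ∃ z : X, ∃ 𝒪 : Set (Set X), 𝒪.Countable ∧ (∀ O ∈ 𝒪, O.Infinite) ∧
      ∀ U : Set X, IsOpen U → z ∈ U → ∃ O ∈ 𝒪, O ⊆ U := by
  -- If such a `Q` exists, all but finitely many of its points lie near `z`, so tails of any
  -- injective sequence in `Q` serve. Otherwise compact infinite sets keep splitting, which yields a
  -- binary tree indexed by the countable set `List Bool`.
  by_cases hcase : ∃ Q : Set X, IsCompact Q ∧ Q.Infinite ∧
      ∀ A B : Set X, A ⊆ Q → B ⊆ Q → IsCompact A → IsCompact B → A.Infinite → B.Infinite →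
        ¬ Disjoint A B
  · obtain ⟨Q, hQ, hQinf, h⟩ := hcase
    obtain ⟨z, -, hz⟩ := hQ.exists_forall_finite_diff hQinf h
    let q := hQinf.natEmbedding
    have hq : Function.Injective fun n => (q n : X) :=
      Subtype.val_injective.comp q.injective
    refine ⟨z, range fun n : ℕ => (fun m => (q m : X)) '' Ici n, countable_range _, ?_, ?_⟩
    · rintro _ ⟨n, rfl⟩
      exact (Ici_infinite n).image hq.injOn
    · intro U hU hzU
      have hfin : {m | (q m : X) ∉ U}.Finite :=
        ((hz U hU hzU).preimage hq.injOn).subset fun m hm => ⟨(q m).2, hm⟩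
      obtain ⟨n, hn⟩ := hfin.bddAbove
      refine ⟨_, ⟨n + 1, rfl⟩, ?_⟩
      rintro _ ⟨m, hm, rfl⟩
      by_contra hmU
      have h1 : m ≤ n := hn hmU
      have h2 : n + 1 ≤ m := hm
      omega
  · push Not at hcase
    let C := {Q : Set X // IsCompact Q ∧ Q.Infinite}
    have hsplit : ∀ Q : C, ∃ A B : C, A.1 ⊆ Q.1 ∧ B.1 ⊆ Q.1 ∧ Disjoint A.1 B.1 := by
      rintro ⟨Q, hQ, hQinf⟩
      obtain ⟨A, B, hAQ, hBQ, hA, hB, hAi, hBi, hAB⟩ := hcase Q hQ hQinf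
      exact ⟨⟨A, hA, hAi⟩, ⟨B, hB, hBi⟩, hAQ, hBQ, hAB⟩
    choose A B hA hB hAB using hsplit
    let P : List Bool → C := fun s => s.foldr (fun b Q => if b then B Q else A Q) ⟨K, hK, hinf⟩
    have hsub : ∀ b s, (P (b :: s)).1 ⊆ (P s).1 := by
      rintro (_ | _) s
      · exact hA (P s)
      · exact hB (P s)
    have hPK : ∀ s, (P s).1 ⊆ K := by
      intro s
      induction s with
      | nil => exact subset_rfl
      | cons b s ih => exact (hsub b s).trans ih
    obtain ⟨L, -, hL⟩ := hK.exists_minimal_meeting (fun s => (P s).1)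
      (fun s => (P s).2.1.isClosed)
      (fun s => (P s).2.2.nonempty.mono fun x hx => ⟨hPK s hx, hx⟩)
    obtain ⟨z, hzL, -⟩ := hL.prop.2 []
    refine ⟨z, range fun s => L ∩ (P s).1, countable_range _, ?_, ?_⟩
    · rintro _ ⟨s, rfl⟩
      exact infinite_inter_of_disjoint_branches (fun s => (P s).1) hsub (fun s => hAB (P s))
        hL.prop.2 s
    · intro U hU hzU
      -- Otherwise `L \ U` would still meet every branch, against minimality of `L`.
      by_contra! hno
      have hmeet : ∀ s, (L \ U ∩ (P s).1).Nonempty := by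
        intro s
        obtain ⟨x, hx, hxU⟩ := not_subset.1 (hno _ ⟨s, rfl⟩)
        exact ⟨x, ⟨hx.1, hxU⟩, hx.2⟩
      exact (hL.le_of_le ⟨hL.prop.1.diff hU, hmeet⟩ sdiff_subset hzL).2 hzU

/-- The circle has no nontrivial subgroup of elements of norm at most `1 / 4`. -/
theorem UnitAddCircle.eq_zero_of_forall_norm_nsmul_le {t : UnitAddCircle}
    (h : ∀ n : ℕ, ‖n • t‖ ≤ 1 / 4) : t = 0 := by
  -- Doubling a representative of size at most 1/4 stays within half a period, so the norm doubles
  -- exactly.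
  have hdouble : ∀ u : UnitAddCircle, ‖u‖ ≤ 1 / 4 → ‖2 • u‖ = 2 * ‖u‖ := by
    intro u hu
    obtain ⟨x, rfl, hx⟩ : ∃ x : ℝ, (x : UnitAddCircle) = u ∧ |x| = ‖u‖ := by
      obtain ⟨y, rfl⟩ := QuotientAddGroup.mk_surjective u
      refine ⟨y - round y, ?_, (UnitAddCircle.norm_eq (x := y)).symm⟩
      rw [AddCircle.coe_sub, sub_eq_self]
      exact (AddCircle.coe_eq_zero_iff 1).2 ⟨round y, by simp⟩
    have habs : |2 • x| = 2 * |x| := by rw [nsmul_eq_mul, abs_mul]; norm_num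
    rw [← hx, ← AddCircle.coe_nsmul, ← habs, AddCircle.norm_coe_eq_abs_iff 1 one_ne_zero, habs,
      hx, abs_one]
    linarith
  have hpow : ∀ n : ℕ, ‖2 ^ n • t‖ = 2 ^ n * ‖t‖ := by
    intro n
    induction n with
    | zero => simp
    | succ n ih =>
      rw [pow_succ', mul_smul, hdouble _ (h _), ih, pow_succ', mul_assoc]
  by_contra ht
  have hpos : 0 < ‖t‖ := norm_pos_iff.2 ht
  obtain ⟨n, hn⟩ := pow_unbounded_of_one_lt (1 / ‖t‖) (one_lt_two : (1 : ℝ) < 2)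
  rw [div_lt_iff₀ hpos, ← hpow] at hn
  linarith [h (2 ^ n)]

/-- On a precompact group only finitely many homomorphisms to the circle are small on a given
nonempty open set. -/
theorem finite_setOf_addMonoidHom_small_on {G : Type*} [AddCommGroup G]
    {F V : Set G} (hF : F.Finite) (hFV : (⋃ x ∈ F, (fun u => x + u) '' V) = univ) :
    {ψ : G →+ UnitAddCircle | ∀ v ∈ V, ‖ψ v‖ ≤ 1 / 12}.Finite := by
  have : Fintype F := hF.fintype
  obtain ⟨N, -, hN, hcov⟩ := Metric.finite_approx_of_totallyBounded
    (isCompact_univ : IsCompact (univ : Set (F → UnitAddCircle))).totallyBounded (1 / 24)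
    (by norm_num)
  have hnet : ∀ ψ : G →+ UnitAddCircle, ∃ y ∈ N, dist (fun f : F => ψ f) y < 1 / 24 := by
    intro ψ
    simpa using hcov (mem_univ fun f : F => ψ f)
  choose r hrN hr using hnet
  refine Finite.of_finite_image (f := r) (hN.subset ?_) ?_
  · rintro _ ⟨ψ, -, rfl⟩
    exact hrN ψ
  · intro ψ hψ φ hφ heq
    -- A shared point of the 1/24-net costs 1/12 on `F`, and `V` costs 2/12, which adds up to 1/4.
    have hsmall : ∀ x, ‖ψ x - φ x‖ ≤ 1 / 4 := by
      intro x
      obtain ⟨f, hf, v, hv, rfl⟩ : ∃ f ∈ F, ∃ v ∈ V, f + v = x := by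
        have hx : x ∈ ⋃ f ∈ F, (fun u => f + u) '' V := hFV ▸ mem_univ x
        obtain ⟨f, hf, v, hv, hfv⟩ := mem_iUnion₂.1 hx
        exact ⟨f, hf, v, hv, hfv⟩
      have h1 := (dist_le_pi_dist _ _ (⟨f, hf⟩ : F)).trans_lt (hr ψ)
      have h2 := (dist_le_pi_dist _ _ (⟨f, hf⟩ : F)).trans_lt (hr φ)
      rw [← heq] at h2
      have h3 := dist_triangle_right (ψ f) (φ f) (r ψ ⟨f, hf⟩)
      rw [dist_eq_norm] at h3
      have h4 : ψ (f + v) - φ (f + v) = (ψ f - φ f) + (ψ v - φ v) := by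
        rw [map_add, map_add]; abel
      rw [h4]
      have h5 := norm_add_le (ψ f - φ f) (ψ v - φ v)
      have h6 := norm_sub_le (ψ v) (φ v)
      have h7 := hψ v hv
      have h8 := hφ v hv
      linarith
    ext x
    refine sub_eq_zero.1 (UnitAddCircle.eq_zero_of_forall_norm_nsmul_le fun n => ?_)
    rw [nsmul_sub, ← map_nsmul, ← map_nsmul]
    exact hsmall _

namespace PointwiseDual

variable {G : Type*} [AddCommGroup G] [TopologicalSpace G]

theorem continuous_eval (x : G) : Continuous fun χ : PointwiseDual G => χ x :=
  (continuous_apply x).comp continuous_induced_dom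

/-- The homomorphism underlying a continuous character. -/
def toHom (χ : PointwiseDual G) : G →+ UnitAddCircle :=
  ContinuousAddMonoidHom.toAddMonoidHom χ

theorem continuous_toHom (χ : PointwiseDual G) : Continuous (toHom χ) :=
  ContinuousAddMonoidHom.continuous_toFun χ

theorem toHom_injective : Function.Injective (toHom (G := G)) :=
  fun _ _ h => DFunLike.ext _ _ fun x => DFunLike.congr_fun h x

instance : T2Space (PointwiseDual G) :=
  T2Space.of_injective_continuous (f := fun (χ : PointwiseDual G) (g : G) => χ g)
    DFunLike.coe_injective continuous_induced_dom

/-- Baire category turns pointwise closeness to `z` into uniform closeness on an open set, for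
infinitely many characters at once. -/
theorem finite_of_isCompact [IsTopologicalAddGroup G] [BaireSpace G]
    (hG : ∀ U : Set G, IsOpen U → U.Nonempty →
      ∃ F : Set G, F.Finite ∧ (⋃ x ∈ F, (fun u => x + u) '' U) = univ)
    {K : Set (PointwiseDual G)} (hK : IsCompact K) : K.Finite := by
  by_contra hinf
  obtain ⟨z, 𝒪, hcount, hO, hz⟩ := hK.exists_countable_infinite_network_at hinf
  let C : Set (PointwiseDual G) → Set G := fun O =>
    {x | ∀ χ ∈ O, ‖toHom χ x - toHom z x‖ ≤ 1 / 24}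
  have hclosed : ∀ O ∈ 𝒪, IsClosed (C O) := by
    intro O _
    simp only [C, ofPred_forall]
    exact isClosed_biInter fun χ _ => isClosed_le
      ((continuous_toHom χ).sub (continuous_toHom z)).norm continuous_const
  have hcover : ⋃ O ∈ 𝒪, C O = univ := by
    refine eq_univ_of_forall fun x => ?_
    have hopen : IsOpen {χ : PointwiseDual G | ‖χ x - z x‖ < 1 / 24} :=
      isOpen_lt ((continuous_eval x).sub continuous_const).norm continuous_const
    obtain ⟨O, hO𝒪, hOU⟩ := hz _ hopen (by simp)
    exact mem_biUnion hO𝒪 fun χ hχ => le_of_lt (hOU hχ)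
  obtain ⟨O, hO𝒪, u, hu⟩ : ∃ O ∈ 𝒪, (interior (C O)).Nonempty := by
    have hd := dense_biUnion_interior_of_closed hclosed hcount hcover
    obtain ⟨x, hx⟩ := hd.nonempty
    obtain ⟨O, hO𝒪, hx⟩ := mem_iUnion₂.1 hx
    exact ⟨O, hO𝒪, x, hx⟩
  -- Translating to the origin subtracts two values bounded by 1/24, hence the bound 1/12 on `V`.
  let V : Set G := (fun v => u + v) ⁻¹' interior (C O)
  obtain ⟨F, hF, hFV⟩ := hG V (isOpen_interior.preimage (continuous_const_add u))
    ⟨0, by simpa [V] using hu⟩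
  refine hO O hO𝒪 (Finite.of_finite_image (f := fun χ => toHom χ - toHom z)
    ((finite_setOf_addMonoidHom_small_on hF hFV).subset ?_)
    fun χ _ φ _ h => toHom_injective (sub_left_injective h))
  rintro _ ⟨χ, hχ, rfl⟩ v hv
  have h1 := interior_subset hv χ hχ
  have h2 := interior_subset hu χ hχ
  have h3 : (toHom χ - toHom z) v =
      (toHom χ (u + v) - toHom z (u + v)) - (toHom χ u - toHom z u) := by
    rw [AddMonoidHom.sub_apply, map_add, map_add]; abel
  rw [h3]
  linarith [norm_sub_le (toHom χ (u + v) - toHom z (u + v)) (toHom χ u - toHom z u)]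

end PointwiseDual

theorem corollary3p1 (G : Type*) [AddCommGroup G] [TopologicalSpace G] [IsTopologicalAddGroup G]
    (hG : IsTotallyBoundedGroup G) (hB : BaireSpace G) : IsGBarrelled G := by
  intro K hK
  have : Finite K := (PointwiseDual.finite_of_isCompact hG.precompact hK).to_subtype
  exact equicontinuous_finite.2 fun χ => PointwiseDual.continuous_toHom χ.1
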